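/- A \emph{quantum fan} in $\mathbb{R}^d$ is a triple $(\Delta, h, \mathcal{I})$, where $h:\mathbb{Z}^n\to\mathbb{R}^d$ is a group morphism with image $\Gamma$, $\mathcal{I}\subset\{1,\dots,n\}$ is such that the $h(e_j)$, $j\notin\mathcal{I}$, span $\mathbb{R}^d$, and $\Delta$ is a fan of strongly convex polyhedral cones generated by elements of $\Gamma$ (closed under faces, any two cones meeting in a common face), together with a set $A\subset\{1,\dots,n\}\setminus\mathcal{I}$ such that the half-lines generated by the $h(e_i)$, $i\in A$, are exactly the $1$-cones of $\Delta$. Write $\Delta(1)$ for the set of $1$-cones and $\Delta_{max}$ for the set of maximal cones. For a subset $S$ of $\Delta$ let $S_h$ be the set of the cones $\mathrm{Cone}(e_j, j\in J)\subset\mathbb{R}^n$ with $J\subset A$ and $\mathrm{Cone}(h(e_j), j\in J)\in S$. Let $d\ge 2$ and let $(\Delta_0,h_0:\mathbb{Z}^{n_0}\to\mathbb{R}^d,\mathcal{I}_0)$, $(\Delta_1,h_1:\mathbb{Z}^{n_1}\to\mathbb{R}^d,\mathcal{I}_1)$ be simplicial quantum fans. An \emph{elementary precobordism} between them consists of a complete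 simplicial quantum fan $(\Delta,h:\mathbb{Z}^n\to\mathbb{R}^{d+1},\mathcal{I})$, two subfans $\widetilde\Delta_0,\widetilde\Delta_1$ of $\Delta$ (subsets of cones closed under faces) and, for $i=0,1$, surjective linear maps $L_i:\mathbb{R}^{d+1}\to\mathbb{R}^d$ and $H_i:\mathbb{Z}^n\to\mathbb{Z}^{n_i}$ such that: (i) $\widetilde\Delta_{0,max}\cap\widetilde\Delta_{1,max}=\emptyset$, and $\Delta_{max}\setminus(\widetilde\Delta_{0,max}\cup\widetilde\Delta_{1,max})$ has exactly one element $\sigma$; (ii) $L_i h=h_iH_i$; the image under $L_i$ of every cone of $\widetilde\Delta_i$ is a cone of $\Delta_i$, and the image under $H_i$ (extended to $\mathbb{R}^n$) of every cone of $\widetilde\Delta_{i,h}$ is a cone of $\Delta_{i,h_i}$; (iii) for $i=0,1$ there is a $1$-cone $\rho_i$ of $\Delta$ with $L_i(\rho_i)=0$ such that the maximal cones of $\widetilde\Delta_i$ are exactly the maximal cones of $\Delta$ that contain $\rho_i$. Its \emph{index} is $(a,b)$, where, among the maximal cones of $\Delta$ that intersect $\sigma$ in a cone of dimension $d$, $a$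 are in $\widetilde\Delta_0$ and $b$ are in $\widetilde\Delta_1$. For every elementary precobordism of index $(a,b)$, $\rho\mapsto L_i(\rho)$ is a bijection from the set of $1$-cones of $\widetilde\Delta_i$ whose image is a $1$-cone of $\Delta_i$ onto $\Delta_i(1)$, for $i=0,1$. Through these bijections, regard $\Delta_0(1)$ and $\Delta_1(1)$ as subsets of $\Delta(1)$. Then: - if $a,b\ge 2$, then $\Delta_0(1)=\Delta_1(1)$ and $|\Delta(1)|=|\Delta_0(1)|+2=|\Delta_1(1)|+2$; - if $a=1$, then $\Delta_0(1)\subsetneq\Delta_1(1)$ and $|\Delta(1)|=|\Delta_0(1)|+3=|\Delta_1(1)|+2$; - if $b=1$, then $\Delta_0(1)\supsetneq\Delta_1(1)$ and $|\Delta(1)|=|\Delta_0(1)|+2=|\Delta_1(1)|+3$. If moreover $L_0=L_1$, then the same relations $=$, $\subsetneq$, $\supsetneq$ hold between $\Delta_0(1)$ and $\Delta_1(1)$ as sets of half-lines of $\mathbb{R}^d$. -/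

import Mathlib

noncomputable section

namespace FanCobordism

/-- The space of polyhedral (or arbitrary pointed convex) cones of `ℝ^d`. -/
abbrev Cone (d : ℕ) : Type := PointedCone ℝ (Fin d → ℝ)

/-- The dimension of a cone: the dimension of the linear subspace that it spans. -/
def coneDim {d : ℕ} (c : Cone d) : ℕ :=
  Module.finrank ℝ (Submodule.span ℝ (c : Set (Fin d → ℝ)))

/-- The inclusion-maximal elements of a family of cones. -/
def maxCones {d : ℕ} (S : Set (Cone d)) : Set (Cone d) :=
  {c | Maximal (fun x => x ∈ S) c}

/-- A calibration of the finitely generated group `Γ = h(ℤ^n) ⊂ ℝ^d`: the epimorphism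
`h : ℤ^n → Γ` and a set of virtual generators, such that the images of the other canonical
generators span the whole space (in particular `Γ` spans it). -/
structure Calibration (d n : ℕ) where
  h : (Fin n → ℤ) →ₗ[ℤ] (Fin d → ℝ)
  virt : Set (Fin n)
  span_eq_top :
    Submodule.span ℝ ((fun j : Fin n => h (Pi.single j 1)) '' virtᶜ) = ⊤

/-- A quantum fan in `ℝ^d`, calibrated by `h : ℤ^n → Γ`: a fan of strongly convex polyhedral cones
generated by elements of `Γ`, and a set `gens` of non-virtual indices `i` such that the half-lines
generated by the `h(e_i)`, `i ∈ gens`, are exactly the one-dimensional cones of the fan. -/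
structure QuantumFan (d n : ℕ) extends Calibration d n where
  cones : Set (Cone d)
  polyhedral : ∀ c ∈ cones,
    ∃ s : Set (Fin d → ℝ), s.Finite ∧ s ⊆ Set.range h ∧ PointedCone.hull ℝ s = c
  stronglyConvex : ∀ c ∈ cones, (c : ConvexCone ℝ (Fin d → ℝ)).Salient
  face_mem : ∀ c ∈ cones, ∀ f : Cone d, f.IsFaceOf c → f ∈ cones
  inter_face : ∀ c ∈ cones, ∀ c' ∈ cones, (c ⊓ c').IsFaceOf c ∧ (c ⊓ c').IsFaceOf c'
  gens : Set (Fin n)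
  gens_not_virt : gens ⊆ virtᶜ
  gens_rays : (fun i : Fin n => PointedCone.hull ℝ {h (Pi.single i 1)}) '' gens
    = {c | c ∈ cones ∧ coneDim c = 1}

namespace QuantumFan

variable {d n : ℕ}

/-- `Δ(1)`, the set of one-dimensional cones. -/
def rays (Δ : QuantumFan d n) : Set (Cone d) := {c | c ∈ Δ.cones ∧ coneDim c = 1}

/-- Every cone is generated by linearly independent vectors. -/
def IsSimplicial (Δ : QuantumFan d n) : Prop := ∀ c ∈ Δ.cones, c.IsSimplicial

/-- The cones cover the whole space. -/
def IsComplete (Δ : QuantumFan d n) : Prop := ∀ x : Fin d → ℝ, ∃ c ∈ Δ.cones, x ∈ c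

/-- For a set `S` of cones of `Δ` (a subfan), the family `S_h` of the cones `Cone(e_j, j ∈ J)` of
`ℝ^n`, with `J` a set of generators of `Δ`, such that `Cone(h(e_j), j ∈ J)` belongs to `S`. -/
def lift (Δ : QuantumFan d n) (S : Set (Cone d)) : Set (Cone n) :=
  {c | ∃ J : Set (Fin n), J ⊆ Δ.gens ∧
    PointedCone.hull ℝ ((fun j : Fin n => Δ.h (Pi.single j 1)) '' J) ∈ S ∧
    c = PointedCone.hull ℝ ((fun j : Fin n => (Pi.single j 1 : Fin n → ℝ)) '' J)}

end QuantumFan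

/-- The `ℝ`-linear extension `ℝ^n → ℝ^m` of a linear map `ℤ^n → ℤ^m`. -/
def realExt {n m : ℕ} (H : (Fin n → ℤ) →ₗ[ℤ] (Fin m → ℤ)) : (Fin n → ℝ) →ₗ[ℝ] (Fin m → ℝ) :=
  Matrix.toLin' ((LinearMap.toMatrix' H).map (fun z : ℤ => (z : ℝ)))

/-- One end `(Δ', π = (L, H))` of a precobordism: a subfan `Δ'` (field `sub`) of the quantum fan `Δ`
of `ℝ^(d+1)` and a pair of onto linear maps, compatible with the calibrations, that sends the cones
of `Δ'` (resp. of its lift to `ℤ^n`) on cones of the quantum fan `Θ` of `ℝ^d` (resp. of its lift).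
As for the part of a normal fan that belongs to the vertices of a facet, the maximal cones of `Δ'`
are the maximal cones of `Δ` that contain a given `1`-cone of `Δ`, which is contracted by `L`. -/
structure CobordismEnd {d n m : ℕ} (Δ : QuantumFan (d + 1) n) (Θ : QuantumFan d m) where
  sub : Set (Cone (d + 1))
  sub_subset : sub ⊆ Δ.cones
  sub_face_mem : ∀ c ∈ sub, ∀ f : Cone (d + 1), f.IsFaceOf c → f ∈ sub
  L : (Fin (d + 1) → ℝ) →ₗ[ℝ] (Fin d → ℝ)
  H : (Fin n → ℤ) →ₗ[ℤ] (Fin m → ℤ)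
  L_surjective : Function.Surjective L
  H_surjective : Function.Surjective H
  comm : ∀ x : Fin n → ℤ, L (Δ.h x) = Θ.h (H x)
  map_mem : ∀ c ∈ sub, c.map L ∈ Θ.cones
  map_lift_mem : ∀ c ∈ Δ.lift sub, c.map (realExt H) ∈ Θ.lift Θ.cones
  exists_ray : ∃ ρ ∈ Δ.rays, ρ.map L = ⊥ ∧
    ∀ c : Cone (d + 1), c ∈ maxCones sub ↔ c ∈ maxCones Δ.cones ∧ ρ ≤ c

/-- The `1`-cones of `Δ'` that `L` sends onto a `1`-cone of `Θ`: this is `Θ(1)` seen, through the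
projection, as a set of `1`-cones of `Δ`. -/
def CobordismEnd.liftedRays {d n m : ℕ} {Δ : QuantumFan (d + 1) n} {Θ : QuantumFan d m}
    (E : CobordismEnd Δ Θ) : Set (Cone (d + 1)) :=
  {ρ | ρ ∈ Δ.rays ∧ ρ ∈ E.sub ∧ ρ.map E.L ∈ Θ.rays}

/-- An elementary precobordism between the simplicial quantum fans `Δ₀` and `Δ₁` of `ℝ^d`. -/
structure Precobordism {d n₀ n₁ : ℕ} (n : ℕ) (Δ₀ : QuantumFan d n₀) (Δ₁ : QuantumFan d n₁) where
  fan : QuantumFan (d + 1) n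
  simplicial_zero : Δ₀.IsSimplicial
  simplicial_one : Δ₁.IsSimplicial
  simplicial : fan.IsSimplicial
  complete : fan.IsComplete
  endZero : CobordismEnd fan Δ₀
  endOne : CobordismEnd fan Δ₁
  disjoint_max : Disjoint (maxCones endZero.sub) (maxCones endOne.sub)
  card_remaining :
    (maxCones fan.cones \ (maxCones endZero.sub ∪ maxCones endOne.sub)).ncard = 1

namespace Precobordism

variable {d n n₀ n₁ : ℕ} {Δ₀ : QuantumFan d n₀} {Δ₁ : QuantumFan d n₁}

/-- The maximal cones of the fan which intersect the unique maximal cone `σ` that lies in neither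
of the two subfans in a cone of dimension `d`. -/
def neighbours (W : Precobordism n Δ₀ Δ₁) : Set (Cone (d + 1)) :=
  {τ | τ ∈ maxCones W.fan.cones ∧
    ∃ σ ∈ maxCones W.fan.cones \ (maxCones W.endZero.sub ∪ maxCones W.endOne.sub),
      coneDim (τ ⊓ σ) = d}

/-- The index `(a, b)`: `a` of the neighbours of `σ` are in the first subfan, `b` in the second. -/
def HasIndex (W : Precobordism n Δ₀ Δ₁) (a b : ℕ) : Prop :=
  (W.neighbours ∩ W.endZero.sub).ncard = a ∧ (W.neighbours ∩ W.endOne.sub).ncard = b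

end Precobordism

end FanCobordism

end

/-! ### Abstract complete simplicial fans: uniqueness and linear independence -/

namespace FanCobordism

/-! The complete simplicial fan is replaced by a simplicial complex on its rays, with existence and
uniqueness of nonnegative representations. Maximal simplexes have `D = d + 1` vertices, and every
facet has a simplex on its other side. Let `p` and `q` be the contracted rays and `s` the simplex of
the remaining cone. Since the kernel of `L_i` is the line through its contracted ray, projection
identifies `Δ₀(1)` and `Δ₁(1)` with the vertices of the links of `p` and `q` (`liftedRays_eq`,
`bijOn_map`).

Every maximal simplex is `s` or contains exactly one of `p`, `q`. For `v` in the link of `p`,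
crossing the facet opposite to `p` in a maximal simplex containing `v` and `p` shows that `v` is in
`s` or in the link of `q` (`linkVertices_subset`). Two distinct neighbours of `s` through `p`
already put all of `s` in the link of `p`, and likewise for `q`. If `a, b ≥ 2`, the links therefore
have the same vertices, and only `p` and `q` are missing.

If `a = 1`, let `j` be the vertex of `s` missed by the only neighbour through `p`. All facets of `s`
containing `j` are then joined to `q`. The simplex `s` and these neighbours fill the star of `j`, so
`j` is not joined to `p` (`pair_notMem`), and the link of `q` has exactly the additional vertex `j`.
The case `b = 1` is symmetric. -/

/-- `K` is the set of simplexes of a complete simplicial fan with ray generators `g`: every vector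
is in a unique way a nonnegative combination of the generators of a simplex. -/
structure IsSimplexFan {ι E : Type*} [Fintype ι] [AddCommGroup E] [Module ℝ E]
    (g : ι → E) (K : Set (Finset ι)) : Prop where
  down : ∀ s ∈ K, ∀ t ⊆ s, t ∈ K
  singleton_mem : ∀ i, {i} ∈ K
  exists_rep : ∀ x : E, ∃ s ∈ K, ∃ w : ι → ℝ,
    (∀ i, 0 ≤ w i) ∧ (∀ i, i ∉ s → w i = 0) ∧ ∑ i, w i • g i = x
  unique : ∀ s ∈ K, ∀ t ∈ K, ∀ w w' : ι → ℝ, (∀ i, 0 ≤ w i) → (∀ i, i ∉ s → w i = 0) →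
    (∀ i, 0 ≤ w' i) → (∀ i, i ∉ t → w' i = 0) →
    ∑ i, w i • g i = ∑ i, w' i • g i → w = w'

namespace IsSimplexFan

section Algebra

variable {ι E : Type*} [Fintype ι] [AddCommGroup E] [Module ℝ E] {g : ι → E} {K : Set (Finset ι)}

/-- The positive and negative parts of `c` represent the same vector on the same simplex, so
uniqueness makes them equal. -/
theorem eq_zero_of_sum_eq_zero (hK : IsSimplexFan g K) {s : Finset ι} (hs : s ∈ K) {c : ι → ℝ}
    (hc : ∀ i, i ∉ s → c i = 0) (h : ∑ i, c i • g i = 0) : c = 0 := by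
  have h1 := hK.unique s hs s hs (fun i => max (c i) 0) (fun i => max (-c i) 0)
    (fun i => le_max_right _ _) (fun i hi => by simp [hc i hi]) (fun i => le_max_right _ _)
    (fun i hi => by simp [hc i hi]) (by
      rw [← sub_eq_zero, ← Finset.sum_sub_distrib, ← h]
      refine Finset.sum_congr rfl fun i _ => ?_
      rw [← sub_smul]
      congr 1
      rcases le_total (c i) 0 with h | h <;> simp [h])
  funext i
  have h2 := congrFun h1 i
  rcases le_total (c i) 0 with h | h <;> simp [h] at h2 <;> simp [h2]

theorem linearIndependent (hK : IsSimplexFan g K) {s : Finset ι} (hs : s ∈ K) :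
    LinearIndependent ℝ (fun i : s => g i) := by
  classical
  rw [Fintype.linearIndependent_iff]
  intro c hc i
  have h := hK.eq_zero_of_sum_eq_zero hs (c := fun i => if h : i ∈ s then c ⟨i, h⟩ else 0)
    (fun i hi => by simp [hi]) (by
      rw [← hc, ← Finset.sum_subset (Finset.subset_univ s)
        (fun i _ hi => by simp [hi]), ← Finset.sum_coe_sort s]
      exact Finset.sum_congr rfl fun i _ => by simp)
  simpa using congrFun h i

theorem card_le (hK : IsSimplexFan g K) [FiniteDimensional ℝ E] {s : Finset ι} (hs : s ∈ K) :
    s.card ≤ Module.finrank ℝ E := by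
  simpa using (hK.linearIndependent hs).fintype_card_le_finrank

/-- A simplex with as many vertices as the dimension spans. -/
theorem exists_coeff (hK : IsSimplexFan g K) [FiniteDimensional ℝ E] {s : Finset ι} (hs : s ∈ K)
    (hcard : s.card = Module.finrank ℝ E) (x : E) :
    ∃ c : ι → ℝ, (∀ i, i ∉ s → c i = 0) ∧ ∑ i, c i • g i = x := by
  classical
  have hspan := (hK.linearIndependent hs).span_eq_top_of_card_eq_finrank' (by simpa using hcard)
  have hx : x ∈ Submodule.span ℝ (Set.range fun i : s => g i) := hspan ▸ Submodule.mem_top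
  rw [Submodule.mem_span_range_iff_exists_fun] at hx
  obtain ⟨c, hc⟩ := hx
  refine ⟨fun i => if h : i ∈ s then c ⟨i, h⟩ else 0, fun i hi => by simp [hi], ?_⟩
  rw [← hc, ← Finset.sum_subset (Finset.subset_univ s)
        (fun i _ hi => by simp [hi]), ← Finset.sum_coe_sort s]
  exact Finset.sum_congr rfl fun i _ => by simp

end Algebra

/-! ### Local structure of a complete fan: maximal simplexes and facet crossing -/

section Topology

variable {ι E : Type*} [Fintype ι] [NormedAddCommGroup E] [NormedSpace ℝ E]
  {g : ι → E} {K : Set (Finset ι)}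

/-- The cone is the image of a closed orthant under an injective linear map from a
finite-dimensional space. -/
theorem isClosed_cone (hK : IsSimplexFan g K) {s : Finset ι} (hs : s ∈ K) :
    IsClosed {x : E | ∃ w : ι → ℝ, (∀ i, 0 ≤ w i) ∧ (∀ i, i ∉ s → w i = 0) ∧
      ∑ i, w i • g i = x} := by
  classical
  have hemb := LinearMap.isClosedEmbedding_of_injective (f := Fintype.linearCombination ℝ
    (fun i : s => g i)) (LinearMap.ker_eq_bot.2 (hK.linearIndependent hs).fintypeLinearCombination_injective)
  have hcl : IsClosed {w : s → ℝ | ∀ i, 0 ≤ w i} := by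
    simp only [Set.ofPred_forall]
    exact isClosed_iInter fun i => isClosed_le continuous_const (continuous_apply i)
  convert! hemb.isClosedMap _ hcl using 1
  ext x
  constructor
  · rintro ⟨w, h0, hw, rfl⟩
    refine ⟨fun i => w i, fun i => h0 _, ?_⟩
    rw [Fintype.linearCombination_apply, ← Finset.sum_subset (Finset.subset_univ s)
        (fun i _ hi => by simp [hw i hi]), ← Finset.sum_coe_sort s]
  · rintro ⟨c, h0, rfl⟩
    refine ⟨fun i => if h : i ∈ s then c ⟨i, h⟩ else 0, fun i => ?_, fun i hi => by simp [hi], ?_⟩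
    · dsimp only
      split_ifs with h
      exacts [h0 _, le_rfl]
    rw [Fintype.linearCombination_apply, ←  Finset.sum_subset (Finset.subset_univ s)
        (fun i _ hi => by simp [hi]), ← Finset.sum_coe_sort s]
    exact Finset.sum_congr rfl fun i _ => by simp

/-- Near `z` in the direction `u`, a complete fan has a cone that contains `z`. -/
theorem exists_simplex_of_direction (hK : IsSimplexFan g K) (z u : E) :
    ∃ s ∈ K, (∃ w : ι → ℝ, (∀ i, 0 ≤ w i) ∧ (∀ i, i ∉ s → w i = 0) ∧ ∑ i, w i • g i = z) ∧
      ∃ ε : ℝ, 0 < ε ∧ ∃ w : ι → ℝ, (∀ i, 0 ≤ w i) ∧ (∀ i, i ∉ s → w i = 0) ∧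
        ∑ i, w i • g i = z + ε • u := by
  -- Among finitely many simplexes, one serves infinitely many points of this sequence; its cone is
  -- closed, hence contains the limit `z`.
  choose F hF hrep using fun k : ℕ => hK.exists_rep (z + (1 / ((k : ℝ) + 1)) • u)
  obtain ⟨s, hs⟩ := Finite.exists_infinite_fiber F
  have hinf : (F ⁻¹' {s}).Infinite := Set.infinite_coe_iff.1 hs
  obtain ⟨k₀, hk₀⟩ := hinf.nonempty
  have hsK : s ∈ K := by
    have : F k₀ = s := hk₀
    exact this ▸ hF k₀
  refine ⟨s, hsK, ?_, 1 / ((k₀ : ℝ) + 1), by positivity, ?_⟩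
  · refine (hK.isClosed_cone hsK).mem_of_frequently_of_tendsto (b := Filter.atTop)
      (x := z) (f := fun k : ℕ => z + (1 / ((k : ℝ) + 1)) • u) ?_ ?_
    · refine (Nat.frequently_atTop_iff_infinite.2 hinf).mono fun k hk => ?_
      have : F k = s := hk
      exact this ▸ hrep k
    · have h := (tendsto_one_div_add_atTop_nhds_zero_nat (𝕜 := ℝ)).smul_const u
      simpa using h.const_add z
  · have : F k₀ = s := hk₀
    exact this ▸ hrep k₀

/-- The sum of the generators of `s` has strictly positive coefficients on `s`, so by uniqueness any
simplex whose cone contains it contains `s`. -/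
theorem exists_simplex_of_simplex (hK : IsSimplexFan g K) {s : Finset ι} (hs : s ∈ K) (u : E) :
    ∃ t ∈ K, s ⊆ t ∧ ∃ ε : ℝ, 0 < ε ∧ ∃ w : ι → ℝ, (∀ i, 0 ≤ w i) ∧ (∀ i, i ∉ t → w i = 0) ∧
        ∑ i, w i • g i = ∑ i ∈ s, g i + ε • u := by
  classical
  obtain ⟨t, ht, ⟨w, h0, hw, hsum⟩, hrest⟩ := hK.exists_simplex_of_direction (∑ i ∈ s, g i) u
  refine ⟨t, ht, fun i hi => ?_, hrest⟩
  have h := hK.unique t ht s hs w (fun i => if i ∈ s then 1 else 0) h0 hw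
    (fun i => by split_ifs <;> norm_num) (fun i hi => by simp [hi]) (by simp [hsum])
  by_contra hit
  have h2 := hw i hit
  rw [h] at h2
  simp [hi] at h2

/-- On the other side of a facet of a maximal cone there is another maximal cone. -/
theorem exists_adjacent [DecidableEq ι] (hK : IsSimplexFan g K) {s : Finset ι} (hs : s ∈ K)
    {i : ι} (hi : i ∈ s) :
    ∃ j, j ∉ s ∧ insert j (s.erase i) ∈ K := by
  obtain ⟨t, ht, hst, ε, hε, w, h0, hw, hsum⟩ :=
    hK.exists_simplex_of_simplex (hK.down s hs _ (Finset.erase_subset i s)) (-g i)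
  -- If `t` contained `i`, the equation would be a relation on `t` whose coefficient at `i` is `w i
  -- + ε > 0`.
  have hit : i ∉ t := fun hit => by
    have hst' : s ⊆ t := fun k hk => by
      by_cases hki : k = i
      · exact hki ▸ hit
      · exact hst (Finset.mem_erase.2 ⟨hki, hk⟩)
    have h := hK.eq_zero_of_sum_eq_zero ht
      (c := fun k => w k - (if k ∈ s.erase i then 1 else 0) + (if k = i then ε else 0))
      (fun k hk => by
        have h1 : k ∉ s.erase i := fun h => hk (hst h)
        have h2 : k ≠ i := fun h => hk (h ▸ hit)
        simp only [h1, h2, hw k hk, if_false]; ring) (by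
        simp only [add_smul, sub_smul, Finset.sum_add_distrib, Finset.sum_sub_distrib, hsum,
          ite_smul, one_smul, zero_smul, Finset.sum_ite_mem, Finset.univ_inter,
          Finset.sum_ite_eq', Finset.mem_univ, if_true, smul_neg]
        abel)
    have h2 := congrFun h i
    simp at h2
    linarith [h0 i]
  -- Without a new vertex the same relation would live on `s`, again with a positive coefficient at
  -- `i`.
  have hne : ∃ j ∈ t, j ∉ s.erase i := by
    by_contra! hts
    have h := hK.eq_zero_of_sum_eq_zero hs
      (c := fun k => w k - (if k ∈ s.erase i then 1 else 0) + (if k = i then ε else 0))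
      (fun k hk => by
        have h1 : k ∉ s.erase i := fun h => hk (Finset.mem_of_mem_erase h)
        have h2 : k ≠ i := fun h => hk (h ▸ hi)
        simp only [h1, h2, hw k (fun h => h1 (hts k h)), if_false]; ring) (by
        simp only [add_smul, sub_smul, Finset.sum_add_distrib, Finset.sum_sub_distrib, hsum,
          ite_smul, one_smul, zero_smul, Finset.sum_ite_mem, Finset.univ_inter,
          Finset.sum_ite_eq', Finset.mem_univ, if_true, smul_neg]
        abel)
    have h2 := congrFun h i
    simp at h2
    linarith [h0 i]
  obtain ⟨j, hjt, hjs⟩ := hne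
  refine ⟨j, fun hj => hjs (Finset.mem_erase.2 ⟨fun h => hit (h ▸ hjt), hj⟩), ?_⟩
  exact hK.down t ht _ (Finset.insert_subset hjt hst)

variable [FiniteDimensional ℝ E]

/-- If the generators of `s` did not span, moving from their sum in a direction `u` outside their
span would reach a simplex containing `s`; by maximality it is `s`, which forces `u` into the span.
-/
theorem card_eq_of_maximal (hK : IsSimplexFan g K) {s : Finset ι}
    (hs : Maximal (fun x => x ∈ K) s) : s.card = Module.finrank ℝ E := by
  classical
  refine (hK.card_le hs.1).antisymm ?_
  by_contra! hlt
  have hne : Submodule.span ℝ (Set.range fun i : s => g i) ≠ ⊤ := fun h => by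
    have := finrank_range_le_card (R := ℝ) (fun i : s => g i)
    rw [Set.finrank, h, finrank_top] at this
    simp at this
    omega
  obtain ⟨u, hu⟩ : ∃ u, u ∉ Submodule.span ℝ (Set.range fun i : s => g i) := by
    by_contra! h
    exact hne (eq_top_iff.2 fun x _ => h x)
  obtain ⟨t, ht, hst, ε, hε, w, h0, hw, hsum⟩ := hK.exists_simplex_of_simplex hs.1 u
  have hts : t ⊆ s := hs.2 ht hst
  apply hu
  have hmem : ∀ i ∈ s, g i ∈ Submodule.span ℝ (Set.range fun i : s => g i) :=
    fun i hi => Submodule.subset_span ⟨⟨i, hi⟩, rfl⟩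
  have h1 : ε • u ∈ Submodule.span ℝ (Set.range fun i : s => g i) := by
    rw [← sub_eq_iff_eq_add'.2 hsum]
    refine Submodule.sub_mem _ (Submodule.sum_mem _ fun i _ => ?_)
      (Submodule.sum_mem _ fun i hi => hmem i hi)
    by_cases hi : i ∈ s
    · exact Submodule.smul_mem _ _ (hmem i hi)
    · simp [hw i (fun h => hi (hts h))]
  exact (Submodule.smul_mem_iff _ hε.ne').1 h1

theorem exists_card_eq (hK : IsSimplexFan g K) {s : Finset ι} (hs : s ∈ K) :
    ∃ t ∈ K, s ⊆ t ∧ t.card = Module.finrank ℝ E := by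
  obtain ⟨t, hst, ht⟩ := (Set.toFinite K).exists_le_maximal hs
  exact ⟨t, ht.1, hst, hK.card_eq_of_maximal ht⟩

end Topology

end IsSimplexFan
end FanCobordism

/-! ### Combinatorics of two stars and one additional simplex -/

namespace FanCobordism

/-- The vertices of the link of the vertex `p`. -/
def linkVertices {ι : Type*} [DecidableEq ι] (K : Set (Finset ι)) (p : ι) : Set ι :=
  {v | v ≠ p ∧ {v, p} ∈ K}

/-- The maximal simplexes of `K`, of cardinality `D`, are `s` and those that contain one of the
vertices `p` and `q`, which are not joined by an edge. -/
structure IsTwoStar {ι : Type*} (K : Set (Finset ι)) (D : ℕ) (p q : ι)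
    (s : Finset ι) : Prop where
  mem : s ∈ K
  card_eq : s.card = D
  left_notMem : p ∉ s
  right_notMem : q ∉ s
  cover : ∀ t ∈ K, t.card = D → t = s ∨ p ∈ t ∨ q ∈ t
  not_both : ∀ t ∈ K, p ∈ t → q ∉ t

/-- The maximal simplexes that contain `p` and a facet of `s`. -/
def adjacentAt {ι : Type*} [DecidableEq ι] (K : Set (Finset ι)) (D : ℕ) (s : Finset ι) (p : ι) :
    Set (Finset ι) :=
  {t | t ∈ K ∧ t.card = D ∧ (t ∩ s).card + 1 = D ∧ p ∈ t}

namespace IsTwoStar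

section

variable {ι : Type*} {K : Set (Finset ι)} {D : ℕ} {p q : ι} {s : Finset ι}

theorem symm (h : IsTwoStar K D p q s) : IsTwoStar K D q p s where
  mem := h.mem
  card_eq := h.card_eq
  left_notMem := h.right_notMem
  right_notMem := h.left_notMem
  cover t ht hc := by rcases h.cover t ht hc with h | h | h <;> simp [h]
  not_both t ht hq hp := h.not_both t ht hp hq

variable [DecidableEq ι]

theorem exists_eq_insert_erase (h : IsTwoStar K D p q s) {t : Finset ι}
    (ht : t ∈ adjacentAt K D s p) : ∃ i ∈ s, t = insert p (s.erase i) := by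
  obtain ⟨-, hc, hi, hp⟩ := ht
  have h1 : (s \ t).card = 1 := by
    have := Finset.card_sdiff_add_card_inter s t
    rw [Finset.inter_comm, h.card_eq] at this
    omega
  have h2 : (t \ s).card = 1 := by
    have := Finset.card_sdiff_add_card_inter t s
    omega
  obtain ⟨i, hi⟩ := Finset.card_eq_one.1 h1
  obtain ⟨j, hj⟩ := Finset.card_eq_one.1 h2
  have hpj : p = j := by
    have : p ∈ t \ s := Finset.mem_sdiff.2 ⟨hp, h.left_notMem⟩
    simpa [hj] using this
  subst hpj
  refine ⟨i, (Finset.mem_sdiff.1 (hi ▸ Finset.mem_singleton_self i)).1, ?_⟩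
  ext k
  have hk1 := Finset.ext_iff.1 hi k
  have hk2 := Finset.ext_iff.1 hj k
  simp only [Finset.mem_sdiff, Finset.mem_singleton, Finset.mem_insert, Finset.mem_erase]
    at hk1 hk2 ⊢
  tauto

theorem insert_erase_mem_adjacentAt (h : IsTwoStar K D p q s) {i : ι} (hi : i ∈ s)
    (ht : insert p (s.erase i) ∈ K) : insert p (s.erase i) ∈ adjacentAt K D s p := by
  have hpe : p ∉ s.erase i := fun hp => h.left_notMem (Finset.mem_of_mem_erase hp)
  have hpos : 0 < s.card := Finset.card_pos.2 ⟨i, hi⟩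
  have hce := h.card_eq
  refine ⟨ht, ?_, ?_, Finset.mem_insert_self _ _⟩
  · rw [Finset.card_insert_of_notMem hpe, Finset.card_erase_of_mem hi]
    omega
  · rw [Finset.insert_inter_of_notMem h.left_notMem,
      Finset.inter_eq_left.2 (Finset.erase_subset i s), Finset.card_erase_of_mem hi]
    omega

end

variable {ι E : Type*} [Fintype ι] [DecidableEq ι] [NormedAddCommGroup E] [NormedSpace ℝ E]
  {g : ι → E} {K : Set (Finset ι)} {p q : ι} {s : Finset ι}

theorem mem_linkVertices (hK : IsSimplexFan g K) {t : Finset ι} (ht : t ∈ K) {v : ι} (hv : v ∈ t)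
    (hp : p ∈ t) (hvp : v ≠ p) : v ∈ linkVertices K p :=
  ⟨hvp, hK.down t ht _ (by simp [Finset.insert_subset_iff, hv, hp])⟩

/-- Two distinct neighbours through `p` omit different vertices of `s`, so each vertex of `s` lies
in at least one of them. -/
theorem subset_linkVertices_of_two_le (hK : IsSimplexFan g K) {D : ℕ}
    (h : IsTwoStar K D p q s) (h2 : 2 ≤ (adjacentAt K D s p).ncard) :
    (s : Set ι) ⊆ linkVertices K p := by
  obtain ⟨t, t', ht, ht', hne⟩ := (Set.one_lt_ncard_iff (Set.toFinite _)).1 h2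
  obtain ⟨i, hi, rfl⟩ := h.exists_eq_insert_erase ht
  obtain ⟨i', hi', rfl⟩ := h.exists_eq_insert_erase ht'
  intro v hv
  have hvp : v ≠ p := fun hvp => h.left_notMem (hvp ▸ hv)
  by_cases hvi : v = i
  · have hvi' : v ≠ i' := fun h => hne (by rw [← hvi, ← h])
    exact mem_linkVertices hK ht'.1 (Finset.mem_insert_of_mem (Finset.mem_erase.2 ⟨hvi', hv⟩))
      (Finset.mem_insert_self _ _) hvp
  · exact mem_linkVertices hK ht.1 (Finset.mem_insert_of_mem (Finset.mem_erase.2 ⟨hvi, hv⟩))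
      (Finset.mem_insert_self _ _) hvp

/-- The two vertices opposite to a common facet are on different sides of this facet. -/
theorem _root_.FanCobordism.IsSimplexFan.coeff_neg (hK : IsSimplexFan g K) (hs : s ∈ K)
    (hq : q ∉ s) {c : ι → ℝ} (hc : ∀ i, i ∉ s → c i = 0) (hsum : ∑ i, c i • g i = g q) {i : ι}
    (hi : insert q (s.erase i) ∈ K) : c i < 0 := by
  by_contra! h0
  obtain ⟨M, hM⟩ : ∃ M : ℝ, ∀ k, -c k ≤ M := by
    obtain ⟨M, hM⟩ := (Set.finite_range fun k => -c k).bddAbove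
    exact ⟨M, fun k => hM ⟨k, rfl⟩⟩
  have hM0 : 0 ≤ M := by
    have := hM q
    rw [hc q hq] at this
    simpa using this
  -- If `c i ≥ 0`, adding a large multiple of the generators of the common facet to `g q` gives a
  -- vector in both cones, with coefficient 0 at `q` in one representation and 1 in the other.
  have h := hK.unique s hs _ hi (fun k => c k + if k ∈ s.erase i then M else 0)
    (fun k => (if k = q then 1 else 0) + if k ∈ s.erase i then M else 0)
    (fun k => by
      by_cases hk : k ∈ s.erase i
      · simp only [hk, if_true]
        linarith [hM k]
      · simp only [hk, if_false, add_zero]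
        by_cases hks : k ∈ s
        · have : k = i := by
            by_contra hki
            exact hk (Finset.mem_erase.2 ⟨hki, hks⟩)
          rwa [this]
        · exact (hc k hks).ge)
    (fun k hk => by simp [hc k hk, hk])
    (fun k => by split_ifs <;> linarith)
    (fun k hk => by
      simp only [Finset.mem_insert, not_or] at hk
      simp only [hk.1, hk.2, if_false, add_zero])
    (by simp only [add_smul, Finset.sum_add_distrib, hsum, ite_smul, one_smul, zero_smul,
          Finset.sum_ite_eq', Finset.mem_univ, if_true])
  have h2 := congrFun h q
  simp [hc q hq, hq] at h2

/-- The maximal simplex across the facet is not `s`, so it contains `p` or `q`, which can only be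
its new vertex. -/
theorem insert_erase_mem (hK : IsSimplexFan g K) (h : IsTwoStar K (Module.finrank ℝ E) p q s)
    {i : ι} (hi : i ∈ s) : insert p (s.erase i) ∈ K ∨ insert q (s.erase i) ∈ K := by
  obtain ⟨j, hj, hjK⟩ := hK.exists_adjacent h.mem hi
  have hjc : (insert j (s.erase i)).card = Module.finrank ℝ E := by
    rw [Finset.card_insert_of_notMem (fun h => hj (Finset.mem_of_mem_erase h)),
      Finset.card_erase_of_mem hi, ← h.card_eq]
    have : 0 < s.card := Finset.card_pos.2 ⟨i, hi⟩
    omega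
  rcases h.cover _ hjK hjc with h1 | h1 | h1
  · exact absurd (h1 ▸ Finset.mem_insert_self _ _) hj
  · left
    rcases Finset.mem_insert.1 h1 with h2 | h2
    · rwa [h2]
    · exact absurd (Finset.mem_of_mem_erase h2) h.left_notMem
  · right
    rcases Finset.mem_insert.1 h1 with h2 | h2
    · rwa [h2]
    · exact absurd (Finset.mem_of_mem_erase h2) h.right_notMem

variable [FiniteDimensional ℝ E]

/-- Crossing the facet opposite to `p` in a maximal simplex through `v` and `p` keeps `v` and loses
`p`; the simplex reached is `s` or contains `q`. -/
theorem linkVertices_subset (hK : IsSimplexFan g K)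
    (h : IsTwoStar K (Module.finrank ℝ E) p q s) :
    linkVertices K p ⊆ linkVertices K q ∪ s := by
  rintro v ⟨hvp, hv⟩
  obtain ⟨t, ht, hst, hc⟩ := hK.exists_card_eq hv
  rw [Finset.insert_subset_iff, Finset.singleton_subset_iff] at hst
  obtain ⟨j, hj, hjK⟩ := hK.exists_adjacent ht hst.2
  have hjc : (insert j (t.erase p)).card = Module.finrank ℝ E := by
    rw [Finset.card_insert_of_notMem (fun h => hj (Finset.mem_of_mem_erase h)),
      Finset.card_erase_of_mem hst.2, ← hc]
    have : 0 < t.card := Finset.card_pos.2 ⟨p, hst.2⟩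
    omega
  have hvm : v ∈ insert j (t.erase p) :=
    Finset.mem_insert_of_mem (Finset.mem_erase.2 ⟨hvp, hst.1⟩)
  rcases h.cover _ hjK hjc with h1 | h1 | h1
  · right
    rw [← h1]
    exact hvm
  · rcases Finset.mem_insert.1 h1 with h2 | h2
    · exact absurd (h2 ▸ hst.2) hj
    · exact absurd rfl (Finset.mem_erase.1 h2).1
  · left
    refine mem_linkVertices hK hjK hvm h1 ?_
    rintro rfl
    exact h.not_both t ht hst.2 hst.1

/-- If every facet of `s` that contains `j` is a facet of a simplex that contains `q`, these
simplexes and `s` are the whole star of `j`. -/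
theorem pair_notMem (hK : IsSimplexFan g K) (hs : s ∈ K) (hcard : s.card = Module.finrank ℝ E)
    (h2 : 2 ≤ s.card) (hp : p ∉ s) (hq : q ∉ s) (hpq : p ≠ q) {j : ι} (hj : j ∈ s)
    (hadj : ∀ i ∈ s, i ≠ j → insert q (s.erase i) ∈ K) : {j, p} ∉ K := by
  intro hjp
  have hpj : p ≠ j := fun h => hp (h ▸ hj)
  obtain ⟨α, hα, hαsum⟩ := hK.exists_coeff hs hcard (g p)
  obtain ⟨c, hc, hcsum⟩ := hK.exists_coeff hs hcard (g q)
  have hneg : ∀ i ∈ s, i ≠ j → c i < 0 :=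
    fun i hi hij => hK.coeff_neg hs hq hc hcsum (hadj i hi hij)
  have hne : (s.erase j).Nonempty := by
    rw [← Finset.card_pos, Finset.card_erase_of_mem hj]
    omega
  -- Write `g p = m • g q + ∑ i, (α i - m * c i) • g i`. As `c i < 0` for `i ∈ s` other than `j`,
  -- the least `m ≥ 0` making all coefficients away from `j` nonnegative is the maximum of 0 and
  -- these ratios. If `m = 0` the support is in `s`; otherwise the coefficient at `i₀` vanishes and
  -- the support is in `insert q (s.erase i₀)`.
  obtain ⟨i₀, hi₀, hmax⟩ := Finset.exists_max_image (s.erase j) (fun i => α i / c i) hne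
  have hi₀' := Finset.mem_erase.1 hi₀
  obtain ⟨m, hm, t, ht, hpt, hjt, hqt, hst, hzero, hnonneg⟩ : ∃ m : ℝ, 0 ≤ m ∧ ∃ t ∈ K, p ∉ t ∧
      j ∈ t ∧ (m ≠ 0 → q ∈ t) ∧ (∀ i ∉ t, m ≠ 0 → i ≠ q) ∧
      (∀ i ∉ t, α i - m * c i = 0) ∧ ∀ i, i ≠ j → 0 ≤ α i - m * c i := by
    rcases le_or_gt (α i₀ / c i₀) 0 with h | h
    · refine ⟨0, le_rfl, s, hs, hp, hj, by simp, by simp, fun i hi => by simp [hα i hi],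
        fun i hij => ?_⟩
      by_cases hi : i ∈ s
      · have h1 := (hmax i (Finset.mem_erase.2 ⟨hij, hi⟩)).trans h
        rw [div_le_iff_of_neg (hneg i hi hij)] at h1
        simpa using h1
      · simp [hα i hi]
    · refine ⟨α i₀ / c i₀, h.le, _, hadj i₀ hi₀'.2 hi₀'.1, ?_, ?_, by simp, ?_, ?_, ?_⟩
      · simp [hp, hpq]
      · simp [hj, hi₀'.1.symm]
      · rintro i hi - rfl
        simp at hi
      · intro i hi
        by_cases hii : i = i₀
        · rw [hii, div_mul_cancel₀ _ (hneg i₀ hi₀'.2 hi₀'.1).ne, sub_self]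
        · have his : i ∉ s := fun h => hi (by simp [h, hii])
          simp [hα i his, hc i his]
      · intro i hij
        by_cases hi : i ∈ s
        · have h1 := hmax i (Finset.mem_erase.2 ⟨hij, hi⟩)
          rw [div_le_iff_of_neg (hneg i hi hij)] at h1
          linarith
        · simp [hα i hi, hc i hi]
  -- Adding `|α j - m * c j| • g j` repairs the sign at `j` and stays in the cone of `{j, p}`. The
  -- two representations differ at `p`, which is not in `t`.
  have h := hK.unique t ht _ hjp
    (fun k => α k - m * c k + (if k = q then m else 0) + if k = j then |α j - m * c j| else 0)
    (fun k => (if k = p then 1 else 0) + if k = j then |α j - m * c j| else 0)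
    (fun k => by
      have h3 : 0 ≤ if k = q then m else 0 := by split_ifs <;> simp [hm]
      by_cases hk : k = j
      · subst hk
        simp only [if_true]
        linarith [neg_abs_le (α k - m * c k)]
      · simp only [hk, if_false]
        linarith [hnonneg k hk])
    (fun k hk => by
      have hkj : k ≠ j := fun h => hk (h ▸ hjt)
      by_cases hm0 : m = 0
      · have := hzero k hk
        simp [hkj, hm0] at this ⊢
        exact this
      · simp [hkj, hst k hk hm0, hzero k hk])
    (fun k => by
      have := abs_nonneg (α j - m * c j)
      split_ifs <;> linarith)
    (fun k hk => by
      simp only [Finset.mem_insert, Finset.mem_singleton, not_or] at hk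
      simp only [hk.1, hk.2, if_false, add_zero])
    (by simp only [add_smul, sub_smul, mul_smul, Finset.sum_add_distrib, Finset.sum_sub_distrib,
          ← Finset.smul_sum, hαsum, hcsum, ite_smul, one_smul, zero_smul,
          Finset.sum_ite_eq', Finset.mem_univ, if_true, sub_add_cancel])
  have h3 := congrFun h p
  simp [hα p hp, hc p hp, hpq, hpj] at h3

/-- A vertex other than `p` and `q` lies in a maximal simplex, which is `s` or contains `p` or `q`;
in each case it is joined to `q`. -/
theorem compl_linkVertices (hK : IsSimplexFan g K) (h : IsTwoStar K (Module.finrank ℝ E) p q s)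
    (hs : (s : Set ι) ⊆ linkVertices K q) : (linkVertices K q)ᶜ = {p, q} := by
  ext v
  simp only [Set.mem_compl_iff, Set.mem_insert_iff, Set.mem_singleton_iff]
  constructor
  · intro hv
    by_contra! hvpq
    obtain ⟨t, ht, hst, hc⟩ := hK.exists_card_eq (hK.singleton_mem v)
    have hvt : v ∈ t := hst (Finset.mem_singleton_self v)
    rcases h.cover t ht hc with h1 | h1 | h1
    · exact hv (hs (h1 ▸ hvt))
    · rcases linkVertices_subset hK h (mem_linkVertices hK ht hvt h1 hvpq.1) with h2 | h2
      exacts [hv h2, hv (hs h2)]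
    · exact hv (mem_linkVertices hK ht hvt h1 hvpq.2)
  · rintro (rfl | rfl) ⟨h1, h2⟩
    · exact h.not_both _ h2 (by simp) (by simp)
    · exact h1 rfl

theorem card_eq_ncard_add_two (hK : IsSimplexFan g K)
    (h : IsTwoStar K (Module.finrank ℝ E) p q s) (hs : (s : Set ι) ⊆ linkVertices K q) :
    Fintype.card ι = (linkVertices K q).ncard + 2 := by
  have hpq : p ≠ q := fun hpq =>
    h.not_both _ (hK.singleton_mem p) (by simp) (by simp [hpq])
  rw [← Nat.card_eq_fintype_card, ← Set.ncard_add_ncard_compl (linkVertices K q),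
    h.compl_linkVertices hK hs, Set.ncard_pair hpq]

theorem linkVertices_eq (hK : IsSimplexFan g K) {D : ℕ}
    (hE : Module.finrank ℝ E = D) (h : IsTwoStar K D p q s)
    (hp : 2 ≤ (adjacentAt K D s p).ncard)
    (hq : 2 ≤ (adjacentAt K D s q).ncard) :
    linkVertices K p = linkVertices K q ∧ Fintype.card ι = (linkVertices K q).ncard + 2 := by
  subst hE
  have h1 := h.subset_linkVertices_of_two_le hK hp
  have h2 := h.symm.subset_linkVertices_of_two_le hK hq
  refine ⟨Set.Subset.antisymm ?_ ?_, h.card_eq_ncard_add_two hK h2⟩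
  · exact (h.linkVertices_subset hK).trans (Set.union_subset le_rfl h2)
  · exact (h.symm.linkVertices_subset hK).trans (Set.union_subset le_rfl h1)

theorem linkVertices_ssubset (hK : IsSimplexFan g K) {D : ℕ}
    (hE : Module.finrank ℝ E = D) (h : IsTwoStar K D p q s) (hD : 3 ≤ D)
    (hp : (adjacentAt K D s p).ncard = 1) :
    linkVertices K p ⊂ linkVertices K q ∧
      (linkVertices K q).ncard = (linkVertices K p).ncard + 1 ∧
      Fintype.card ι = (linkVertices K q).ncard + 2 := by
  subst hE
  have hpq : p ≠ q := fun hpq =>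
    h.not_both _ (hK.singleton_mem p) (by simp) (by simp [hpq])
  obtain ⟨t, ht⟩ := Set.ncard_eq_one.1 hp
  have htmem : t ∈ adjacentAt K _ s p := ht ▸ Set.mem_singleton t
  obtain ⟨j, hj, rfl⟩ := h.exists_eq_insert_erase htmem
  -- A neighbour through `p` missing `i ≠ j` would be a second one.
  have hadj : ∀ i ∈ s, i ≠ j → insert q (s.erase i) ∈ K := fun i hi hij => by
    refine (h.insert_erase_mem hK hi).resolve_left fun hi' => ?_
    have h1 := h.insert_erase_mem_adjacentAt hi hi'
    rw [ht, Set.mem_singleton_iff] at h1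
    have h2 : i ∈ insert p (s.erase i) := h1 ▸ by simp [hi, hij]
    rcases Finset.mem_insert.1 h2 with h3 | h3
    · exact h.left_notMem (h3 ▸ hi)
    · simp at h3
  have hsp : ∀ v ∈ s, v ≠ j → v ∈ linkVertices K p := fun v hv hvj =>
    mem_linkVertices hK htmem.1 (by simp [hv, hvj]) (by simp)
      fun hvp => h.left_notMem (hvp ▸ hv)
  have hsq : (s : Set ι) ⊆ linkVertices K q := fun v hv => by
    -- This is where `3 ≤ D` matters: the facet opposite to a third vertex `i` contains `v` and is
    -- joined to `q`.
    obtain ⟨i, hi, hiv⟩ : ∃ i ∈ s, i ∉ ({v, j} : Finset ι) := by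
      by_contra! hsub
      have := Finset.card_le_card (show s ⊆ {v, j} from hsub)
      have h2 : ({v, j} : Finset ι).card ≤ 2 := Finset.card_le_two
      have := h.card_eq
      omega
    simp only [Finset.mem_insert, Finset.mem_singleton, not_or] at hiv
    exact mem_linkVertices hK (hadj i hi hiv.2)
      (Finset.mem_insert_of_mem (Finset.mem_erase.2 ⟨Ne.symm hiv.1, hv⟩)) (by simp)
      fun hvq => h.right_notMem (hvq ▸ hv)
  have hj_not : j ∉ linkVertices K p := fun hjp =>
    pair_notMem hK h.mem h.card_eq (by have := h.card_eq; omega) h.left_notMem h.right_notMem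
      hpq hj hadj hjp.2
  have hqp : linkVertices K q = insert j (linkVertices K p) := by
    apply Set.Subset.antisymm
    · intro v hv
      rcases h.symm.linkVertices_subset hK hv with h1 | h1
      · exact Or.inr h1
      · by_cases hvj : v = j
        · exact Or.inl hvj
        · exact Or.inr (hsp v h1 hvj)
    · refine Set.insert_subset (hsq hj) ?_
      exact (h.linkVertices_subset hK).trans (Set.union_subset le_rfl hsq)
  refine ⟨hqp ▸ Set.ssubset_insert hj_not, ?_, h.card_eq_ncard_add_two hK hsq⟩
  rw [hqp, Set.ncard_insert_of_notMem hj_not]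

end IsTwoStar
end FanCobordism

/-! ### Faces of simplicial cones -/

noncomputable section

namespace FanCobordism

section ConeHull

variable {κ E : Type*} [Fintype κ] [AddCommGroup E] [Module ℝ E] {b : κ → E}

theorem mem_hull_image_iff {s : Set κ} {x : E} : x ∈ PointedCone.hull ℝ (b '' s) ↔
    ∃ w : κ → ℝ, (∀ i, 0 ≤ w i) ∧ (∀ i, i ∉ s → w i = 0) ∧ ∑ i, w i • b i = x := by
  classical
  constructor
  · intro hx
    induction hx using Submodule.span_induction with
    | mem x hx =>
      obtain ⟨i, hi, rfl⟩ := hx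
      refine ⟨fun k => if k = i then 1 else 0, fun k => ?_, fun k hk => ?_, by simp⟩
      · dsimp only
        split_ifs <;> norm_num
      · exact if_neg (by rintro rfl; exact hk hi)
    | zero => exact ⟨0, by simp, by simp, by simp⟩
    | add x y _ _ hx hy =>
      obtain ⟨w, h0, hw, rfl⟩ := hx
      obtain ⟨w', h0', hw', rfl⟩ := hy
      exact ⟨w + w', fun i => add_nonneg (h0 i) (h0' i), fun i hi => by simp [hw i hi, hw' i hi],
        by simp [add_smul, Finset.sum_add_distrib]⟩
    | smul r x _ hx =>
      obtain ⟨w, h0, hw, rfl⟩ := hx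
      refine ⟨fun i => r.1 * w i, fun i => mul_nonneg r.2 (h0 i), fun i hi => by simp [hw i hi], ?_⟩
      simp only [mul_smul, ← Finset.smul_sum]
      rfl
  · rintro ⟨w, h0, hw, rfl⟩
    refine Submodule.sum_mem _ fun i _ => ?_
    by_cases hi : i ∈ s
    · exact PointedCone.smul_mem _ (h0 i) (PointedCone.subset_hull ⟨i, hi, rfl⟩)
    · simp [hw i hi]

theorem mem_hull_range_iff {x : E} : x ∈ PointedCone.hull ℝ (Set.range b) ↔
    ∃ w : κ → ℝ, (∀ i, 0 ≤ w i) ∧ ∑ i, w i • b i = x := by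
  rw [← Set.image_univ, mem_hull_image_iff]
  simp

theorem mem_hull_singleton_iff {g x : E} :
    x ∈ PointedCone.hull ℝ {g} ↔ ∃ r : ℝ, 0 ≤ r ∧ r • g = x := by
  rw [PointedCone.hull, Submodule.mem_span_singleton]
  exact ⟨fun ⟨r, hr⟩ => ⟨r.1, r.2, hr⟩, fun ⟨r, h0, hr⟩ => ⟨⟨r, h0⟩, hr⟩⟩

theorem hull_singleton_smul {r : ℝ} (hr : 0 < r) (g : E) :
    PointedCone.hull ℝ {r • g} = PointedCone.hull ℝ {g} := by
  ext x
  simp only [mem_hull_singleton_iff]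
  constructor
  · rintro ⟨a, ha, rfl⟩
    exact ⟨a * r, by positivity, mul_smul _ _ _⟩
  · rintro ⟨a, ha, rfl⟩
    exact ⟨a / r, by positivity, by rw [smul_smul, div_mul_cancel₀ _ hr.ne']⟩

theorem isFaceOf_hull_image (hb : LinearIndependent ℝ b) (s : Set κ) :
    (PointedCone.hull ℝ (b '' s)).IsFaceOf (PointedCone.hull ℝ (Set.range b)) := by
  refine ⟨Submodule.span_mono (Set.image_subset_range b s), ?_⟩
  intro x y a hx hy ha hxy
  rw [mem_hull_range_iff] at hx hy
  obtain ⟨w, h0, rfl⟩ := hx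
  obtain ⟨w', h0', rfl⟩ := hy
  rw [mem_hull_image_iff] at hxy ⊢
  obtain ⟨v, -, hv, hsum⟩ := hxy
  refine ⟨w, h0, fun i hi => ?_, rfl⟩
  have h := Fintype.linearIndependent_iff.1 hb (fun i => v i - (a * w i + w' i)) (by
    simp only [sub_smul, add_smul, mul_smul, Finset.sum_sub_distrib, Finset.sum_add_distrib, hsum,
      Finset.smul_sum, sub_self]) i
  rw [hv i hi] at h
  nlinarith [h0 i, h0' i, mul_nonneg ha.le (h0 i)]

/-- A face containing a nonnegative combination contains each generator with a positive coefficient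
in it. -/
theorem eq_hull_image_of_isFaceOf {f : PointedCone ℝ E}
    (hf : f.IsFaceOf (PointedCone.hull ℝ (Set.range b))) :
    f = PointedCone.hull ℝ (b '' {i | b i ∈ f}) := by
  apply le_antisymm
  · intro x hx
    obtain ⟨w, h0, rfl⟩ := mem_hull_range_iff.1 (hf.le hx)
    rw [mem_hull_image_iff]
    refine ⟨w, h0, fun i hi => ?_, rfl⟩
    by_contra hne
    exact hi (hf.mem_of_sum_smul_mem (fun i => PointedCone.subset_hull ⟨i, rfl⟩) h0 hx i
      ((h0 i).lt_of_ne' hne))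
  · rw [PointedCone.hull, Submodule.span_le]
    rintro _ ⟨i, hi, rfl⟩
    exact hi

theorem span_coe_hull (s : Set E) :
    Submodule.span ℝ (PointedCone.hull ℝ s : Set E) = Submodule.span ℝ s := by
  apply le_antisymm
  · rw [Submodule.span_le]
    exact PointedCone.hull_le_span ℝ s
  · exact Submodule.span_mono PointedCone.subset_hull

theorem exists_linearIndependent_of_isSimplicial {c : PointedCone ℝ E} (hc : c.IsSimplicial) :
    ∃ t : Finset E, LinearIndependent ℝ (fun x : t => (x : E)) ∧
      PointedCone.hull ℝ (Set.range fun x : t => (x : E)) = c := by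
  obtain ⟨t, hfin, hli, rfl⟩ := hc
  lift t to Finset E using hfin
  exact ⟨t, hli, by simp⟩

end ConeHull

theorem coneDim_hull_singleton {D : ℕ} {g : Fin D → ℝ} (hg : g ≠ 0) :
    coneDim (PointedCone.hull ℝ {g}) = 1 := by
  rw [coneDim, span_coe_hull, finrank_span_singleton hg]

theorem coneDim_bot {D : ℕ} : coneDim (⊥ : Cone D) = 0 := by
  simp [coneDim]

/-! ### The simplicial complex of a quantum fan -/

namespace QuantumFan

variable {D n : ℕ} {Δ : QuantumFan D n}

theorem exists_generator (ρ : Δ.rays) : ∃ g, g ≠ 0 ∧ PointedCone.hull ℝ {g} = ρ.1 := by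
  have h : ρ.1 ∈ {c | c ∈ Δ.cones ∧ coneDim c = 1} := ρ.2
  rw [← Δ.gens_rays] at h
  obtain ⟨i, -, hi⟩ := h
  dsimp only at hi
  refine ⟨_, ?_, hi⟩
  intro h0
  have h1 := ρ.2.2
  rw [← hi, h0] at h1
  rw [coneDim, span_coe_hull, Submodule.span_zero_singleton, finrank_bot] at h1
  exact zero_ne_one h1

/-- A generator of a `1`-cone. -/
def generator (ρ : Δ.rays) : Fin D → ℝ := (exists_generator ρ).choose

theorem generator_ne_zero (ρ : Δ.rays) : generator ρ ≠ 0 := (exists_generator ρ).choose_spec.1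

theorem hull_generator (ρ : Δ.rays) : PointedCone.hull ℝ {generator ρ} = ρ.1 :=
  (exists_generator ρ).choose_spec.2

theorem generator_mem_iff {ρ : Δ.rays} {c : Cone D} : generator ρ ∈ c ↔ ρ.1 ≤ c := by
  rw [← hull_generator ρ, PointedCone.hull, Submodule.span_le, Set.singleton_subset_iff]
  rfl

theorem finite_rays (Δ : QuantumFan D n) : Δ.rays.Finite := by
  rw [rays, ← Δ.gens_rays]
  exact (Set.toFinite _).image _

instance : Fintype Δ.rays := Δ.finite_rays.fintype

/-- The simplexes of a simplicial fan, as sets of `1`-cones. -/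
def simplexes (Δ : QuantumFan D n) : Set (Finset Δ.rays) :=
  {s | PointedCone.hull ℝ (generator '' (s : Set Δ.rays)) ∈ Δ.cones}

open Classical in
/-- The `1`-cones contained in a cone. -/
def verts (Δ : QuantumFan D n) (c : Cone D) : Finset Δ.rays :=
  Finset.univ.filter fun ρ => ρ.1 ≤ c

@[simp]
theorem mem_verts {c : Cone D} {ρ : Δ.rays} : ρ ∈ Δ.verts c ↔ ρ.1 ≤ c := by
  simp [verts]

theorem isFaceOf_of_le {c c' : Cone D} (hc : c ∈ Δ.cones) (hc' : c' ∈ Δ.cones) (h : c ≤ c') :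
    c.IsFaceOf c' := by
  have := (Δ.inter_face c hc c' hc').2
  rwa [inf_eq_left.2 h] at this

theorem inf_mem {c c' : Cone D} (hc : c ∈ Δ.cones) (hc' : c' ∈ Δ.cones) : c ⊓ c' ∈ Δ.cones :=
  Δ.face_mem c hc _ (Δ.inter_face c hc c' hc').1

theorem exists_ray_eq_hull {c : Cone D} (hc : c ∈ Δ.cones) {t : Finset (Fin D → ℝ)}
    (hli : LinearIndependent ℝ (fun x : t => (x : Fin D → ℝ)))
    (ht : PointedCone.hull ℝ (Set.range fun x : t => (x : Fin D → ℝ)) = c) (x : t) :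
    ∃ ρ : Δ.rays, PointedCone.hull ℝ {x.1} = ρ.1 := by
  refine ⟨⟨PointedCone.hull ℝ {x.1}, Δ.face_mem c hc _ ?_,
    coneDim_hull_singleton (hli.ne_zero x)⟩, rfl⟩
  have := isFaceOf_hull_image hli {x}
  rwa [Set.image_singleton, ht] at this

theorem hull_verts (hS : Δ.IsSimplicial) {c : Cone D} (hc : c ∈ Δ.cones) :
    PointedCone.hull ℝ (generator '' (Δ.verts c : Set Δ.rays)) = c := by
  apply le_antisymm
  · rw [PointedCone.hull, Submodule.span_le]
    rintro _ ⟨ρ, hρ, rfl⟩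
    exact generator_mem_iff.2 (mem_verts.1 hρ)
  · obtain ⟨t, hli, ht⟩ := exists_linearIndependent_of_isSimplicial (hS c hc)
    conv_lhs => rw [← ht]
    rw [PointedCone.hull, Submodule.span_le]
    rintro _ ⟨x, rfl⟩
    obtain ⟨ρ, hρ⟩ := exists_ray_eq_hull hc hli ht x
    have hxρ : x.1 ∈ ρ.1 := hρ ▸ PointedCone.subset_hull rfl
    have hle : ρ.1 ≤ c := by
      rw [← hρ, ← ht]
      exact Submodule.span_mono (Set.singleton_subset_iff.2 ⟨x, rfl⟩)
    rw [← hull_generator] at hxρ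
    exact Submodule.span_mono (Set.singleton_subset_iff.2
      (Set.mem_image_of_mem _ (Finset.mem_coe.2 (mem_verts.2 hle)))) hxρ

/-- Each ray of the fan inside `c` is a face of `c`, hence contains one of the independent
generators of `c`. The chosen ray generators are thus positive rescalings of distinct members of
that independent family. -/
theorem linearIndependent_verts (hS : Δ.IsSimplicial) {c : Cone D} (hc : c ∈ Δ.cones) :
    LinearIndependent ℝ (fun ρ : Δ.verts c => generator ρ.1) := by
  obtain ⟨t, hli, ht⟩ := exists_linearIndependent_of_isSimplicial (hS c hc)
  have hex : ∀ ρ : Δ.verts c, ∃ x : t, ∃ r : ℝ, 0 < r ∧ r • generator ρ.1 = x := by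
    rintro ⟨ρ, hρ⟩
    have hf := isFaceOf_of_le ρ.2.1 hc (mem_verts.1 hρ)
    rw [← ht] at hf
    have heq := eq_hull_image_of_isFaceOf hf
    obtain ⟨x, hx⟩ : {x : t | x.1 ∈ ρ.1}.Nonempty := by
      rw [Set.nonempty_iff_ne_empty]
      intro h
      rw [h, Set.image_empty, PointedCone.hull, Submodule.span_empty] at heq
      have h1 := ρ.2.2
      rw [heq, coneDim_bot] at h1
      exact zero_ne_one h1
    have hx' : x.1 ∈ ρ.1 := hx
    rw [← hull_generator, mem_hull_singleton_iff] at hx'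
    obtain ⟨r, h0, hr⟩ := hx'
    refine ⟨x, r, h0.lt_of_ne fun h => hli.ne_zero x ?_, hr⟩
    rw [← hr, ← h, zero_smul]
  choose x r hr hx using hex
  have hinj : Function.Injective x := by
    intro ρ ρ' h
    apply Subtype.ext
    apply Subtype.ext
    rw [← hull_generator, ← hull_generator, ← hull_singleton_smul (hr ρ), hx, h, ← hx,
      hull_singleton_smul (hr ρ')]
  have h1 := (hli.comp x hinj).units_smul (fun ρ => (Units.mk0 (r ρ) (hr ρ).ne')⁻¹)
  convert! h1 using 1
  funext ρ
  simp only [Pi.smul_apply', Function.comp_apply, ← hx, Units.smul_def, Units.val_inv_eq_inv_val,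
    Units.val_mk0, inv_smul_smul₀ (hr ρ).ne']

/-- A ray of the cone outside `s` would lie in the span of the others, against the independence of
all rays of the cone. -/
theorem verts_hull (hS : Δ.IsSimplicial) {s : Finset Δ.rays} (hs : s ∈ Δ.simplexes) :
    Δ.verts (PointedCone.hull ℝ (generator '' (s : Set Δ.rays))) = s := by
  set c := PointedCone.hull ℝ (generator '' (s : Set Δ.rays)) with hcdef
  have hc : c ∈ Δ.cones := hs
  have hsub : s ⊆ Δ.verts c := fun ρ hρ => mem_verts.2
    (generator_mem_iff.1 (PointedCone.subset_hull ⟨ρ, hρ, rfl⟩))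
  refine (Finset.Subset.antisymm hsub fun ρ hρ => ?_).symm
  by_contra hρs
  have hli := linearIndependent_verts hS hc
  have h1 := hli.notMem_span_image (s := {ρ' | ρ'.1 ∈ s}) (x := ⟨ρ, hρ⟩) hρs
  apply h1
  have h2 : generator ρ ∈ c := generator_mem_iff.2 (mem_verts.1 hρ)
  refine Submodule.span_mono ?_ (PointedCone.hull_le_span ℝ _ h2)
  rintro _ ⟨ρ', hρ', rfl⟩
  exact ⟨⟨ρ', hsub hρ'⟩, hρ', rfl⟩

theorem verts_mem (hS : Δ.IsSimplicial) {c : Cone D} (hc : c ∈ Δ.cones) :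
    Δ.verts c ∈ Δ.simplexes := by
  rw [simplexes, Set.mem_ofPred_eq, hull_verts hS hc]
  exact hc

theorem verts_subset_iff (hS : Δ.IsSimplicial) {c c' : Cone D} (hc : c ∈ Δ.cones)
    (hc' : c' ∈ Δ.cones) : Δ.verts c ⊆ Δ.verts c' ↔ c ≤ c' := by
  constructor
  · intro h
    rw [← hull_verts hS hc, ← hull_verts hS hc']
    exact Submodule.span_mono (Set.image_mono h)
  · intro h ρ hρ
    exact mem_verts.2 ((mem_verts.1 hρ).trans h)

theorem verts_inf [DecidableEq Δ.rays] (c c' : Cone D) :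
    Δ.verts (c ⊓ c') = Δ.verts c ∩ Δ.verts c' := by
  ext
  simp

theorem coneDim_eq_card (hS : Δ.IsSimplicial) {c : Cone D} (hc : c ∈ Δ.cones) :
    coneDim c = (Δ.verts c).card := by
  have h := finrank_span_eq_card (linearIndependent_verts hS hc)
  rw [Fintype.card_coe] at h
  rw [← h, coneDim]
  conv_lhs => rw [← hull_verts hS hc]
  rw [span_coe_hull]
  rw [Set.image_eq_range]
  rfl

theorem isSimplexFan (hS : Δ.IsSimplicial) (hC : Δ.IsComplete) :
    IsSimplexFan (generator (Δ := Δ)) Δ.simplexes where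
  down s hs t hts := by
    have hc : PointedCone.hull ℝ (generator '' (s : Set Δ.rays)) ∈ Δ.cones := hs
    refine Δ.face_mem _ hc _ ?_
    have hli := linearIndependent_verts hS hc
    rw [verts_hull hS hs] at hli
    convert! isFaceOf_hull_image hli {ρ | ρ.1 ∈ t} using 2
    · ext x
      constructor
      · rintro ⟨ρ, hρ, rfl⟩
        exact ⟨⟨ρ, hts hρ⟩, hρ, rfl⟩
      · rintro ⟨ρ, hρ, rfl⟩
        exact ⟨ρ.1, hρ, rfl⟩
    · ext x
      simp
  singleton_mem ρ := by
    rw [simplexes, Set.mem_ofPred_eq, Finset.coe_singleton, Set.image_singleton, hull_generator]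
    exact ρ.2.1
  exists_rep x := by
    obtain ⟨c, hc, hx⟩ := hC x
    refine ⟨Δ.verts c, verts_mem hS hc, ?_⟩
    rw [← hull_verts hS hc, mem_hull_image_iff] at hx
    exact hx
  unique s hs t ht w w' h0 hw h0' hw' hsum := by
    have hcs : PointedCone.hull ℝ (generator '' (s : Set Δ.rays)) ∈ Δ.cones := hs
    have hct : PointedCone.hull ℝ (generator '' (t : Set Δ.rays)) ∈ Δ.cones := ht
    have hf := Δ.inter_face _ hcs _ hct
    -- The common vector lies in the intersection of the two cones, a face of the first; so every
    -- summand lies there, and a ray with `w i ≠ 0` lies in the second cone. Both representations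
    -- then live on the independent family `t`.
    have hsupp : ∀ i, i ∉ t → w i = 0 := by
      intro i hi
      by_contra hne
      have hmem : ∀ k, w k • generator k ∈
          PointedCone.hull ℝ (generator '' (s : Set Δ.rays)) := fun k => by
        by_cases hk : k ∈ s
        · exact PointedCone.smul_mem _ (h0 k) (PointedCone.subset_hull ⟨k, hk, rfl⟩)
        · simp [hw k hk]
      have h1 := hf.1.mem_of_sum_mem hmem ⟨mem_hull_image_iff.2 ⟨w, h0, hw, rfl⟩,
        mem_hull_image_iff.2 ⟨w', h0', hw', hsum.symm⟩⟩ i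
      have h2 := (PointedCone.smul_mem_iff _ ((h0 i).lt_of_ne' hne)).1 h1.2
      exact hi (verts_hull hS ht ▸ mem_verts.2 (generator_mem_iff.1 h2))
    have hli := linearIndependent_verts hS hct
    rw [verts_hull hS ht, Fintype.linearIndependent_iff] at hli
    funext i
    by_cases hi : i ∈ t
    · refine sub_eq_zero.1 (hli (fun k => w k - w' k) ?_ ⟨i, hi⟩)
      rw [Finset.sum_coe_sort t (fun k => (w k - w' k) • generator k),
        Finset.sum_subset (Finset.subset_univ t)
          (fun k _ hk => by simp [hsupp k hk, hw' k hk])]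
      simp [sub_smul, hsum]
    · rw [hsupp i hi, hw' i hi]

theorem mem_maxCones_iff (hS : Δ.IsSimplicial) (hC : Δ.IsComplete) {c : Cone D} :
    c ∈ maxCones Δ.cones ↔ c ∈ Δ.cones ∧ (Δ.verts c).card = D := by
  have hK := isSimplexFan hS hC
  constructor
  · intro hc
    have hc1 : c ∈ Δ.cones := hc.1
    refine ⟨hc1, ?_⟩
    have := hK.card_eq_of_maximal (s := Δ.verts c) ⟨verts_mem hS hc1, fun t ht hct => ?_⟩
    · simpa using this
    have hle : c ≤ PointedCone.hull ℝ (generator '' (t : Set Δ.rays)) := by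
      rw [← verts_subset_iff hS hc1 ht, verts_hull hS ht]
      exact hct
    have := (verts_subset_iff hS ht hc1).2 (hc.2 ht hle)
    rwa [verts_hull hS ht] at this
  · rintro ⟨hc, hcard⟩
    refine ⟨hc, fun c' hc' hle => ?_⟩
    have h1 := (verts_subset_iff hS hc hc').2 hle
    have h2 := hK.card_le (verts_mem hS hc')
    rw [Module.finrank_fin_fun] at h2
    rw [← verts_subset_iff hS hc' hc, Finset.eq_of_subset_of_card_le h1 (h2.trans hcard.ge)]

end QuantumFan
end FanCobordism

end

/-! ### The ends of a precobordism as stars of the contracted rays -/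

noncomputable section

namespace FanCobordism

open QuantumFan

theorem map_hull {D d : ℕ} (L : (Fin D → ℝ) →ₗ[ℝ] (Fin d → ℝ)) (s : Set (Fin D → ℝ)) :
    (PointedCone.hull ℝ s).map L = PointedCone.hull ℝ (L '' s) :=
  Submodule.map_span _ _

theorem QuantumFan.finite_cones {D n : ℕ} {Δ : QuantumFan D n} (hS : Δ.IsSimplicial) :
    Δ.cones.Finite :=
  Set.Finite.of_injOn (f := Δ.verts) (t := Set.univ) (fun _ _ => Set.mem_univ _)
    (fun _ hc _ hc' h => le_antisymm ((verts_subset_iff hS hc hc').1 h.subset)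
      ((verts_subset_iff hS hc' hc).1 h.superset)) Set.finite_univ

namespace CobordismEnd

variable {d n m : ℕ} {Δ : QuantumFan (d + 1) n} {Θ : QuantumFan d m} (E : CobordismEnd Δ Θ)

/-- The `1`-cone that is contracted. -/
def ray : Δ.rays := ⟨E.exists_ray.choose, E.exists_ray.choose_spec.1⟩

theorem map_ray : E.ray.1.map E.L = ⊥ := E.exists_ray.choose_spec.2.1

theorem mem_maxCones_sub {c : Cone (d + 1)} :
    c ∈ maxCones E.sub ↔ c ∈ maxCones Δ.cones ∧ E.ray.1 ≤ c :=
  E.exists_ray.choose_spec.2.2 c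

theorem L_generator_ray : E.L (generator E.ray) = 0 := by
  have h : E.L (generator E.ray) ∈ E.ray.1.map E.L := ⟨_, generator_mem_iff.2 le_rfl, rfl⟩
  rw [map_ray] at h
  simpa using h

theorem exists_smul_of_L_eq_zero {x : Fin (d + 1) → ℝ} (hx : E.L x = 0) :
    ∃ t : ℝ, x = t • generator E.ray := by
  have h1 := E.L.finrank_range_add_finrank_ker
  rw [LinearMap.range_eq_top.2 E.L_surjective, finrank_top, Module.finrank_fin_fun,
    Module.finrank_fin_fun] at h1
  have h2 : Module.finrank ℝ (LinearMap.ker E.L) = 1 := by omega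
  obtain ⟨t, ht⟩ := (finrank_eq_one_iff_of_nonzero'
    (⟨generator E.ray, E.L_generator_ray⟩ : LinearMap.ker E.L)
    (fun h => generator_ne_zero E.ray (congrArg Subtype.val h))).1 h2 ⟨x, hx⟩
  exact ⟨t, (congrArg Subtype.val ht).symm⟩

/-- The subfan is finite and closed under faces, so its maximal cones determine it: it is the closed
star of the contracted ray. -/
theorem mem_sub_iff (hS : Δ.IsSimplicial) {c : Cone (d + 1)} :
    c ∈ E.sub ↔ c ∈ Δ.cones ∧ ∃ τ ∈ maxCones Δ.cones, E.ray.1 ≤ τ ∧ c ≤ τ := by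
  constructor
  · intro hc
    obtain ⟨τ, hcτ, hτ⟩ := ((finite_cones hS).subset E.sub_subset).exists_le_maximal hc
    have h := E.mem_maxCones_sub.1 hτ
    exact ⟨E.sub_subset hc, τ, h.1, h.2, hcτ⟩
  · rintro ⟨hc, τ, hτ, hle, hcτ⟩
    have h : τ ∈ E.sub := (E.mem_maxCones_sub.2 ⟨hτ, hle⟩).1
    exact E.sub_face_mem τ h c (isFaceOf_of_le hc hτ.1 hcτ)

variable {E}

theorem hull_mem_sub (hS : Δ.IsSimplicial) (hC : Δ.IsComplete) {t : Finset Δ.rays}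
    (ht : t ∈ Δ.simplexes) (hray : E.ray ∈ t) :
    PointedCone.hull ℝ (generator '' (t : Set Δ.rays)) ∈ E.sub := by
  obtain ⟨t', ht', htt', hcard⟩ := (isSimplexFan hS hC).exists_card_eq ht
  rw [Module.finrank_fin_fun] at hcard
  refine (E.mem_sub_iff hS).2 ⟨ht, PointedCone.hull ℝ (generator '' (t' : Set Δ.rays)),
    (mem_maxCones_iff hS hC).2 ⟨ht', ?_⟩, ?_, Submodule.span_mono (Set.image_mono htt')⟩
  · rwa [verts_hull hS ht']
  · rw [← generator_mem_iff]
    exact PointedCone.subset_hull ⟨_, htt' hray, rfl⟩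

theorem mem_sub_of_le_hull (hS : Δ.IsSimplicial) (hC : Δ.IsComplete) {t : Finset Δ.rays}
    (ht : t ∈ Δ.simplexes) (hray : E.ray ∈ t) {ρ : Δ.rays} (hρ : ρ ∈ t) : ρ.1 ∈ E.sub := by
  refine E.sub_face_mem _ (hull_mem_sub hS hC ht hray) _ (isFaceOf_of_le ρ.2.1 ht ?_)
  rw [← generator_mem_iff]
  exact PointedCone.subset_hull ⟨_, hρ, rfl⟩

open scoped Classical in
-- In the star, only the contracted ray has zero image: the generator of another such ray would be
-- proportional to that of the contracted ray, against independence in a simplex containing both.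
theorem liftedRays_eq (hS : Δ.IsSimplicial) (hC : Δ.IsComplete) :
    E.liftedRays = Subtype.val '' linkVertices Δ.simplexes E.ray := by
  have hK := isSimplexFan hS hC
  ext c
  constructor
  · rintro ⟨hc, hsub, hmap⟩
    refine ⟨⟨c, hc⟩, ⟨?_, ?_⟩, rfl⟩
    · rintro h
      have h1 := hmap.2
      rw [show c = E.ray.1 from congrArg Subtype.val h, map_ray, coneDim_bot] at h1
      exact zero_ne_one h1
    · obtain ⟨-, τ, hτ, hle, hcτ⟩ := (E.mem_sub_iff hS).1 hsub
      refine hK.down _ (verts_mem hS hτ.1) _ ?_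
      simp [Finset.insert_subset_iff, hle, hcτ]
  · rintro ⟨v, ⟨hne, hv⟩, rfl⟩
    have hsub : v.1 ∈ E.sub := mem_sub_of_le_hull hS hC hv (by simp) (by simp)
    refine ⟨v.2, hsub, E.map_mem _ hsub, ?_⟩
    rw [← hull_generator, map_hull, Set.image_singleton]
    refine coneDim_hull_singleton fun h0 => ?_
    obtain ⟨t, ht⟩ := E.exists_smul_of_L_eq_zero h0
    have h := hK.eq_zero_of_sum_eq_zero hv
      (c := fun k => (if k = v then 1 else 0) - if k = E.ray then t else 0)
      (fun k hk => by
        simp only [Finset.mem_insert, Finset.mem_singleton, not_or] at hk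
        simp [hk.1, hk.2])
      (by simp [sub_smul, ite_smul, Finset.sum_sub_distrib, ht])
    have h2 := congrFun h v
    simp [hne] at h2

theorem injOn_map (hS : Δ.IsSimplicial) (hC : Δ.IsComplete) :
    Set.InjOn (fun ρ : Cone (d + 1) => ρ.map E.L) E.liftedRays := by
  classical
  have hK := isSimplexFan hS hC
  rw [liftedRays_eq hS hC]
  rintro _ ⟨v, ⟨hv, hvK⟩, rfl⟩ _ ⟨v', ⟨hv', hvK'⟩, rfl⟩ h
  simp only at h
  have hmem : E.L (generator v') ∈ v.1.map E.L :=
    h ▸ ⟨_, generator_mem_iff.2 le_rfl, rfl⟩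
  rw [← hull_generator, map_hull, Set.image_singleton, mem_hull_singleton_iff] at hmem
  obtain ⟨r, hr, hrv⟩ := hmem
  obtain ⟨t, ht⟩ := E.exists_smul_of_L_eq_zero (x := generator v' - r • generator v)
    (by simp [hrv])
  by_contra hne
  have hne' : v' ≠ v := fun h => hne (by rw [h])
  -- According to the sign of `t`, either `g v' = r • g v + t • g p` or `r • g v = g v' + (-t) • g
  -- p` gives one vector two representations, where `g` is `generator` and `p` is `E.ray`.
  rcases le_total 0 t with h0 | h0
  · have h1 := hK.unique _ (hK.singleton_mem v') _ hvK (fun k => if k = v' then 1 else 0)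
      (fun k => (if k = v then r else 0) + if k = E.ray then t else 0)
      (fun k => by split_ifs <;> norm_num) (fun k hk => by
        rw [Finset.mem_singleton] at hk
        simp [hk])
      (fun k => by split_ifs <;> linarith)
      (fun k hk => by
        simp only [Finset.mem_insert, Finset.mem_singleton, not_or] at hk
        simp [hk.1, hk.2])
      (by simp [add_smul, ite_smul, Finset.sum_add_distrib, ← ht])
    have h2 := congrFun h1 v'
    simp [hne', hv'] at h2
  · have h1 := hK.unique _ (hK.singleton_mem v) _ hvK' (fun k => if k = v then r else 0)
      (fun k => (if k = v' then 1 else 0) + if k = E.ray then -t else 0)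
      (fun k => by split_ifs <;> linarith) (fun k hk => by
        rw [Finset.mem_singleton] at hk
        simp [hk])
      (fun k => by split_ifs <;> linarith)
      (fun k hk => by
        simp only [Finset.mem_insert, Finset.mem_singleton, not_or] at hk
        simp [hk.1, hk.2])
      (by simp [add_smul, ite_smul, Finset.sum_add_distrib, ← ht])
    have h2 := congrFun h1 v'
    simp [hne', hv'] at h2

theorem surjOn_map (hS : Δ.IsSimplicial) (hC : Δ.IsComplete) :
    Set.SurjOn (fun ρ : Cone (d + 1) => ρ.map E.L) E.liftedRays Θ.rays := by
  classical
  have hK := isSimplexFan hS hC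
  intro r hr
  obtain ⟨u, hu⟩ := E.L_surjective (generator ⟨r, hr⟩)
  -- Moving from the contracted generator towards a lift `u` of the generator of `r` stays in a cone
  -- of the star. Its image is a cone of `Θ` containing `r`, so `r` is a face of it and is spanned
  -- by the image of a ray of `t`.
  obtain ⟨t, ht, hray, ε, hε, w, h0, hw, hsum⟩ :=
    hK.exists_simplex_of_simplex (hK.singleton_mem E.ray) u
  rw [Finset.singleton_subset_iff] at hray
  have hcone := E.map_mem _ (hull_mem_sub hS hC ht hray)
  have hle : r ≤ (PointedCone.hull ℝ (generator '' (t : Set Δ.rays))).map E.L := by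
    refine generator_mem_iff (ρ := ⟨r, hr⟩).1 ?_
    rw [← PointedCone.smul_mem_iff _ hε]
    refine ⟨_, mem_hull_image_iff.2 ⟨w, h0, hw, hsum⟩, ?_⟩
    simp [L_generator_ray, hu]
  have hface := isFaceOf_of_le hr.1 hcone hle
  rw [map_hull, Set.image_image, Set.image_eq_range] at hface
  have heq := eq_hull_image_of_isFaceOf (b := fun ρ : t => E.L (generator ρ.1)) hface
  obtain ⟨ρ, hρ, hρ0⟩ : ∃ ρ : t, E.L (generator ρ.1) ∈ r ∧ E.L (generator ρ.1) ≠ 0 := by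
    by_contra! hall
    have hbot : r = ⊥ := by
      rw [eq_bot_iff, heq, PointedCone.hull, Submodule.span_le]
      rintro _ ⟨ρ, hρ, rfl⟩
      exact hall ρ hρ
    have h1 := hr.2
    rw [hbot, coneDim_bot] at h1
    exact zero_ne_one h1
  have hmap : ρ.1.1.map E.L = r := by
    have hρ' : E.L (generator ρ.1) ∈ PointedCone.hull ℝ {generator ⟨r, hr⟩} := by
      rwa [hull_generator]
    obtain ⟨a, ha, haρ⟩ := mem_hull_singleton_iff.1 hρ'
    have ha' : 0 < a := ha.lt_of_ne (by
      rintro rfl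
      exact hρ0 (by rw [← haρ, zero_smul]))
    rw [← hull_generator, map_hull, Set.image_singleton, ← haρ, hull_singleton_smul ha',
      hull_generator]
  exact ⟨ρ.1.1, ⟨ρ.1.2, mem_sub_of_le_hull hS hC ht hray ρ.2, hmap ▸ hr⟩, hmap⟩

theorem bijOn_map (hS : Δ.IsSimplicial) (hC : Δ.IsComplete) :
    Set.BijOn (fun ρ : Cone (d + 1) => ρ.map E.L) E.liftedRays Θ.rays :=
  ⟨fun _ hρ => hρ.2.2, injOn_map hS hC, surjOn_map hS hC⟩

open scoped Classical in
theorem ncard_rays_eq (hS : Δ.IsSimplicial) (hC : Δ.IsComplete) :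
    Θ.rays.ncard = (linkVertices Δ.simplexes E.ray).ncard := by
  have h := E.bijOn_map hS hC
  rw [← h.image_eq, h.injOn.ncard_image, liftedRays_eq hS hC,
    Set.ncard_image_of_injective _ Subtype.val_injective]

open scoped Classical in
-- The dimension of an intersection of cones is its number of common rays. A maximal cone in the
-- subfan must itself contain the contracted ray.
theorem ncard_neighbours (hS : Δ.IsSimplicial) (hC : Δ.IsComplete) {σ : Cone (d + 1)}
    (hσ : σ ∈ Δ.cones) :
    ({τ | τ ∈ maxCones Δ.cones ∧ coneDim (τ ⊓ σ) = d} ∩ E.sub).ncard =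
      (adjacentAt Δ.simplexes (d + 1) (Δ.verts σ) E.ray).ncard := by
  refine Set.ncard_congr (fun τ _ => Δ.verts τ) ?_ ?_ ?_
  · rintro τ ⟨⟨hτ, hdim⟩, hsub⟩
    obtain ⟨-, τ', hτ', hle, hττ'⟩ := (E.mem_sub_iff hS).1 hsub
    refine ⟨verts_mem hS hτ.1, ((mem_maxCones_iff hS hC).1 hτ).2, ?_, ?_⟩
    · rw [← verts_inf, ← coneDim_eq_card hS (inf_mem hτ.1 hσ), hdim]
    · exact mem_verts.2 (hle.trans (hτ.2 hτ'.1 hττ'))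
  · rintro τ τ' ⟨⟨hτ, -⟩, -⟩ ⟨⟨hτ', -⟩, -⟩ h
    exact le_antisymm ((verts_subset_iff hS hτ.1 hτ'.1).1 h.subset)
      ((verts_subset_iff hS hτ'.1 hτ.1).1 h.superset)
  · rintro t ⟨ht, hcard, hinter, hray⟩
    refine ⟨_, ⟨⟨(mem_maxCones_iff hS hC).2 ⟨ht, ?_⟩, ?_⟩, hull_mem_sub hS hC ht hray⟩,
      verts_hull hS ht⟩
    · rw [verts_hull hS ht, hcard]
    · rw [coneDim_eq_card hS (inf_mem ht hσ), verts_inf, verts_hull hS ht]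
      omega

end CobordismEnd

namespace Precobordism

variable {d n n₀ n₁ : ℕ} {Δ₀ : QuantumFan d n₀} {Δ₁ : QuantumFan d n₁}

theorem exists_isTwoStar (W : Precobordism n Δ₀ Δ₁) : ∃ σ ∈ W.fan.cones,
    W.neighbours = {τ | τ ∈ maxCones W.fan.cones ∧ coneDim (τ ⊓ σ) = d} ∧
    IsTwoStar W.fan.simplexes (d + 1) W.endZero.ray W.endOne.ray (W.fan.verts σ) := by
  have hS := W.simplicial
  have hC := W.complete
  have hK := isSimplexFan hS hC
  obtain ⟨σ, hσ⟩ := Set.ncard_eq_one.1 W.card_remaining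
  have hσm : σ ∈ maxCones W.fan.cones \ (maxCones W.endZero.sub ∪ maxCones W.endOne.sub) :=
    hσ ▸ Set.mem_singleton σ
  obtain ⟨hσ1, hσ2⟩ := hσm
  rw [Set.mem_union, CobordismEnd.mem_maxCones_sub, CobordismEnd.mem_maxCones_sub, not_or] at hσ2
  have hmax : ∀ t ∈ W.fan.simplexes, t.card = d + 1 →
      PointedCone.hull ℝ (generator '' (t : Set W.fan.rays)) ∈ maxCones W.fan.cones :=
    fun t ht hc => (mem_maxCones_iff hS hC).2 ⟨ht, by rwa [verts_hull hS ht]⟩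
  have hmem : ∀ t ∈ W.fan.simplexes, ∀ ρ : W.fan.rays,
      ρ.1 ≤ PointedCone.hull ℝ (generator '' (t : Set W.fan.rays)) ↔ ρ ∈ t :=
    fun t ht ρ => by rw [← mem_verts, verts_hull hS ht]
  refine ⟨σ, hσ1.1, ?_, verts_mem hS hσ1.1, ((mem_maxCones_iff hS hC).1 hσ1).2, ?_, ?_, ?_, ?_⟩
  · simp only [neighbours, hσ, Set.mem_singleton_iff, exists_eq_left]
  · exact fun h => hσ2.1 ⟨hσ1, mem_verts.1 h⟩
  · exact fun h => hσ2.2 ⟨hσ1, mem_verts.1 h⟩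
  · intro t ht hc
    by_contra! h
    have h1 : PointedCone.hull ℝ (generator '' (t : Set W.fan.rays)) ∈
        maxCones W.fan.cones \ (maxCones W.endZero.sub ∪ maxCones W.endOne.sub) := by
      refine ⟨hmax t ht hc, ?_⟩
      rw [Set.mem_union, CobordismEnd.mem_maxCones_sub, CobordismEnd.mem_maxCones_sub,
        hmem t ht, hmem t ht]
      tauto
    rw [hσ, Set.mem_singleton_iff] at h1
    exact h.1 (by rw [← h1, verts_hull hS ht])
  -- A maximal simplex containing both contracted rays would give a maximal cone common to the two
  -- subfans.
  · intro t ht hp hq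
    obtain ⟨t', ht', htt', hc⟩ := hK.exists_card_eq ht
    rw [Module.finrank_fin_fun] at hc
    exact Set.disjoint_left.1 W.disjoint_max
      (W.endZero.mem_maxCones_sub.2 ⟨hmax t' ht' hc, (hmem t' ht' _).2 (htt' hp)⟩)
      (W.endOne.mem_maxCones_sub.2 ⟨hmax t' ht' hc, (hmem t' ht' _).2 (htt' hq)⟩)

end Precobordism

end FanCobordism

end

/-! ### The comparison of the ray sets -/

theorem mainTheorem9 {d n n₀ n₁ : ℕ} (hd : 2 ≤ d)
    (Δ₀ : FanCobordism.QuantumFan d n₀) (Δ₁ : FanCobordism.QuantumFan d n₁)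
    (W : FanCobordism.Precobordism n Δ₀ Δ₁) (a b : ℕ) (hab : W.HasIndex a b) :
    -- the projections identify `Δ₀(1)` and `Δ₁(1)` with sets of `1`-cones of `Δ`
    Set.BijOn (fun ρ => ρ.map W.endZero.L) W.endZero.liftedRays Δ₀.rays ∧
    Set.BijOn (fun ρ => ρ.map W.endOne.L) W.endOne.liftedRays Δ₁.rays ∧
    (2 ≤ a → 2 ≤ b →
      W.endZero.liftedRays = W.endOne.liftedRays ∧
      (W.endZero.L = W.endOne.L → Δ₀.rays = Δ₁.rays) ∧
      W.fan.rays.ncard = Δ₀.rays.ncard + 2 ∧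
      W.fan.rays.ncard = Δ₁.rays.ncard + 2) ∧
    (a = 1 →
      W.endZero.liftedRays ⊂ W.endOne.liftedRays ∧
      (W.endZero.L = W.endOne.L → Δ₀.rays ⊂ Δ₁.rays) ∧
      W.fan.rays.ncard = Δ₀.rays.ncard + 3 ∧
      W.fan.rays.ncard = Δ₁.rays.ncard + 2) ∧
    (b = 1 →
      W.endOne.liftedRays ⊂ W.endZero.liftedRays ∧
      (W.endZero.L = W.endOne.L → Δ₁.rays ⊂ Δ₀.rays) ∧
      W.fan.rays.ncard = Δ₀.rays.ncard + 2 ∧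
      W.fan.rays.ncard = Δ₁.rays.ncard + 3) := by
  classical
  have hS := W.simplicial
  have hC := W.complete
  have hK := FanCobordism.QuantumFan.isSimplexFan hS hC
  have bij₀ := W.endZero.bijOn_map hS hC
  have bij₁ := W.endOne.bijOn_map hS hC
  obtain ⟨σ, hσ, hnb, htwo⟩ := W.exists_isTwoStar
  obtain ⟨rfl, rfl⟩ := hab
  rw [hnb, W.endZero.ncard_neighbours hS hC hσ, W.endOne.ncard_neighbours hS hC hσ]
  have hcard₀ := W.endZero.ncard_rays_eq hS hC
  have hcard₁ := W.endOne.ncard_rays_eq hS hC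
  have hcard : W.fan.rays.ncard = Fintype.card W.fan.rays := by
    rw [← Nat.card_coe_set_eq, Nat.card_eq_fintype_card]
  have hdim : Module.finrank ℝ (Fin (d + 1) → ℝ) = d + 1 := Module.finrank_fin_fun ℝ
  have himage : W.endZero.L = W.endOne.L →
      Δ₀.rays = (fun ρ => ρ.map W.endOne.L) '' W.endZero.liftedRays := fun hL => by
    rw [← bij₀.image_eq, hL]
  have hlift₀ := W.endZero.liftedRays_eq hS hC
  have hlift₁ := W.endOne.liftedRays_eq hS hC
  refine ⟨bij₀, bij₁, fun ha hb => ?_, fun ha => ?_, fun hb => ?_⟩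
  · obtain ⟨h1, h2⟩ := FanCobordism.IsTwoStar.linkVertices_eq hK hdim htwo ha hb
    have hl : W.endZero.liftedRays = W.endOne.liftedRays := by rw [hlift₀, hlift₁, h1]
    refine ⟨hl, fun hL => by rw [himage hL, hl, bij₁.image_eq], ?_, ?_⟩
    · rw [hcard, hcard₀, h2, h1]
    · rw [hcard, hcard₁, h2]
  · obtain ⟨h1, h2, h3⟩ := FanCobordism.IsTwoStar.linkVertices_ssubset hK hdim htwo (by omega) ha
    have hl : W.endZero.liftedRays ⊂ W.endOne.liftedRays := by
      rw [hlift₀, hlift₁]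
      exact Subtype.val_injective.image_strictMono h1
    refine ⟨hl, fun hL => ?_, by omega, by omega⟩
    rw [himage hL, ← bij₁.image_eq]
    -- The inclusion stays strict after projection because the common map is injective on the larger
    -- set of lifted rays.
    exact (Set.image_mono hl.1).ssubset_of_ne fun h =>
      hl.ne ((bij₁.injOn.image_eq_image_iff hl.1 le_rfl).1 h)
  · obtain ⟨h1, h2, h3⟩ := FanCobordism.IsTwoStar.linkVertices_ssubset hK hdim htwo.symm (by omega) hb
    have hl : W.endOne.liftedRays ⊂ W.endZero.liftedRays := by
      rw [hlift₀, hlift₁]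
      exact Subtype.val_injective.image_strictMono h1
    refine ⟨hl, fun hL => ?_, by omega, by omega⟩
    rw [← bij₀.image_eq, ← bij₁.image_eq, ← hL]
    exact (Set.image_mono hl.1).ssubset_of_ne fun h =>
      hl.ne ((bij₀.injOn.image_eq_image_iff hl.1 le_rfl).1 h)
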